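/- For nonzero integers $a_1,\dots,a_n$, the pretzel link $P(a_1,\dots,a_n)\subset S^3$ is the link obtained from $n$ vertical two-strand braids $\sigma^{a_1},\dots,\sigma^{a_n}$ (where $\sigma$ is the generator of the two-strand braid group), placed side by side, by joining, both at the top and at the bottom, the right-hand strand of each braid to the left-hand strand of the cyclically next one by a bridge. For an oriented link $L$ with components $c\in C$, the multivariable Alexander polynomial $\Delta(L)\in\mathbb{Z}[t_c^{\pm1}: c\in C]$, with one variable for the meridian of each component, is the greatest common divisor (well defined up to units) of the first elementary ideal of the Alexander matrix of $L$, that is, of the $(N-1)\times(N-1)$ minors of the Fox Jacobian of the Wirtinger presentation (with $N$ generators) of $\pi_1(S^3\setminus L)$ over the group ring $\mathbb{Z}[H_1(S^3\setminus L)]=\mathbb{Z}[t_c^{\pm1}: c\in C]$. Let $q,r\ge 1$ be integers and let $P_{q,r}=P(-2r-1,\,2q,\,-2q,\,2r+1)$. Then, for every orientation of $P_{q,r}$, the multivariable Alexander polynomial of $P_{q,r}$ is identically zero: $\Delta(P_{q,r})=0$. -/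

import Mathlib

noncomputable section

/-! ## Fox calculus -/

namespace Fox

variable {α : Type*} [DecidableEq α]

/-- The Fox derivative `∂w/∂x_a` of a word `w` in the letters `x_b` (written `(b, true)`) and
`x_b⁻¹` (written `(b, false)`), computed from `∂(uv) = ∂u + u ∂v`, `∂x_b/∂x_a = δ_{ab}` and
`∂x_b⁻¹/∂x_a = -x_b⁻¹ δ_{ab}`. -/
def wordDeriv (a : α) : List (α × Bool) → MonoidAlgebra ℤ (FreeGroup α)
  | [] => 0
  | (b, true) :: w =>
      (if b = a then 1 else 0) + MonoidAlgebra.of ℤ _ (FreeGroup.of b) * wordDeriv a w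
  | (b, false) :: w =>
      MonoidAlgebra.of ℤ _ (FreeGroup.of b)⁻¹ * (wordDeriv a w - (if b = a then 1 else 0))

theorem wordDeriv_append (a : α) (u v : List (α × Bool)) :
    wordDeriv a (u ++ v) =
      wordDeriv a u + MonoidAlgebra.of ℤ _ (FreeGroup.mk u) * wordDeriv a v := by
  induction u with
  | nil =>
    have h : (FreeGroup.mk ([] : List (α × Bool))) = 1 := rfl
    simp only [List.nil_append, wordDeriv, h, map_one, one_mul, zero_add]
  | cons x u ih =>
    obtain ⟨b, s⟩ := x
    cases s
    · have h : FreeGroup.mk ((b, false) :: u) = (FreeGroup.of b)⁻¹ * FreeGroup.mk u := rfl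
      rw [List.cons_append, wordDeriv, wordDeriv, ih, h, map_mul]
      noncomm_ring
    · have h : FreeGroup.mk ((b, true) :: u) = FreeGroup.of b * FreeGroup.mk u := rfl
      rw [List.cons_append, wordDeriv, wordDeriv, ih, h, map_mul]
      noncomm_ring

theorem wordDeriv_step (a : α) {u v : List (α × Bool)} (h : FreeGroup.Red.Step u v) :
    wordDeriv a u = wordDeriv a v := by
  cases h with
  | @not L₁ L₂ b s =>
    have key : wordDeriv a ((b, s) :: (b, !s) :: L₂) = wordDeriv a L₂ := by
      cases s
      · simp only [Bool.not_false, wordDeriv, add_sub_cancel_left]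
        rw [← mul_assoc, ← map_mul, inv_mul_cancel, map_one, one_mul]
      · simp only [Bool.not_true, wordDeriv]
        rw [← mul_assoc, ← map_mul, mul_inv_cancel, map_one, one_mul, add_sub_cancel]
    rw [wordDeriv_append, wordDeriv_append, key]

/-- The Fox derivative `∂/∂x_a : F → ℤ[F]` on the free group `F` on the letters `x_b`. -/
def deriv (a : α) (w : FreeGroup α) : MonoidAlgebra ℤ (FreeGroup α) :=
  Quot.lift (wordDeriv a) (fun _ _ h => wordDeriv_step a h) w

theorem deriv_of (a b : α) : deriv a (FreeGroup.of b) = if b = a then 1 else 0 := by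
  change wordDeriv a [(b, true)] = _
  simp [wordDeriv]

theorem deriv_mul (a : α) (u v : FreeGroup α) :
    deriv a (u * v) = deriv a u + MonoidAlgebra.of ℤ _ u * deriv a v := by
  induction u using Quot.inductionOn with
  | _ u =>
    induction v using Quot.inductionOn with
    | _ v => exact wordDeriv_append a u v

/-- The Fox Jacobian of the presentation `⟨x_a (a ∈ α) | r_i (i ∈ ι)⟩`, with entries mapped to
`ℤ[G]` by a homomorphism `φ` from the free group to `G`. -/
def jacobian {ι G : Type*} [Group G] (r : ι → FreeGroup α) (φ : FreeGroup α →* G) :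
    Matrix ι α (MonoidAlgebra ℤ G) :=
  Matrix.of fun i a => MonoidAlgebra.mapDomainRingHom ℤ φ (deriv a (r i))

end Fox

/-- The `k`-th elementary ideal of a matrix `A` with `N` columns, generated by its minors of
size `N - k`. (If `N ≤ k` it contains the empty minor `1`; if there are fewer than `N - k` rows,
then a row is repeated in each of these determinants, and the ideal is zero.) -/
def elementaryIdeal {ι κ R : Type*} [CommRing R] (A : Matrix ι κ R) (k : ℕ) : Ideal R :=
  Ideal.span {m | ∃ (f : Fin (Nat.card κ - k) → ι) (g : Fin (Nat.card κ - k) → κ),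
    m = (A.submatrix f g).det}

/-! ## Link diagrams -/

/-- The combinatorial data of an unoriented link diagram without crossingless circles.
Every crossing has four ends, numbered `0, 1, 2, 3` counterclockwise; opposite ends belong to the
same strand. The ends `upper c` and `upper c + 2` belong to the upper strand at `c`, the other two
to the lower strand. Each end is the end of an edge of the diagram, and `glue` sends it to the other
end of that edge. Planarity of the gluing pattern is not recorded: none of the constructions below
depends on it, and the pretzel patterns below come with their drawing in the plane. -/
structure LinkDiagram where
  Crossing : Type
  finite_crossing : Finite Crossing
  upper : Crossing → Fin 4
  glue : Crossing × Fin 4 → Crossing × Fin 4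
  glue_glue : ∀ h, glue (glue h) = h
  glue_ne : ∀ h, glue h ≠ h

namespace LinkDiagram

variable (D : LinkDiagram)

/-- The ends of edges at crossings. -/
abbrev End : Type := D.Crossing × Fin 4

/-- The end across the crossing, on the same strand. -/
def opp (h : D.End) : D.End := (h.1, h.2 + 2)

/-- The end `h` belongs to the upper strand at its crossing. -/
def IsOver (h : D.End) : Prop := h.2 = D.upper h.1 ∨ h.2 = D.upper h.1 + 2

/-- The components of the link: one walks along edges and straight across crossings. -/
def Component : Type := Quot fun h h' : D.End => h' = D.glue h ∨ h' = D.opp h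

/-- The arcs of the diagram: one walks along edges and across crossings on the upper strand. -/
def Arc : Type := Quot fun h h' : D.End => h' = D.glue h ∨ (D.IsOver h ∧ h' = D.opp h)

/-- The component of an end. -/
def component (h : D.End) : D.Component := Quot.mk _ h

/-- The arc of an end. -/
def arc (h : D.End) : D.Arc := Quot.mk _ h

/-- The component of an arc. -/
def arcComponent (x : D.Arc) : D.Component :=
  Quot.lift D.component
    (fun _ _ h => Quot.sound (h.elim Or.inl fun h => Or.inr h.2)) x

/-- An orientation of the link: `incoming h` says that the strand through the end `h` runs
towards the crossing there. -/
structure Orientation where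
  incoming : D.End → Bool
  incoming_glue : ∀ h, incoming (D.glue h) = !incoming h
  incoming_opp : ∀ h, incoming (D.opp h) = !incoming h

variable {D}

theorem opp_opp (h : D.End) : D.opp (D.opp h) = h := by
  simp [opp, add_assoc]

theorem opp_ne (h : D.End) : D.opp h ≠ h := by
  obtain ⟨c, i⟩ := h
  intro e
  have e2 := congrArg Prod.snd e
  fin_cases i <;> simp [opp] at e2

theorem glue_ne_iterate (n : ℕ) : ∀ h : D.End, (fun x => D.glue (D.opp x))^[n] h ≠ D.glue h := by
  induction n using Nat.twoStepInduction with
  | zero => exact fun h e => D.glue_ne h e.symm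
  | one =>
    intro h e
    exact opp_ne h (by simpa [D.glue_glue] using congrArg D.glue e)
  | more n ih _ =>
    intro h e
    rw [Function.iterate_succ_apply'] at e
    have e1 := congrArg D.glue e
    rw [D.glue_glue, D.glue_glue] at e1
    have e2 := congrArg D.opp e1
    rw [opp_opp, Function.iterate_succ_apply] at e2
    apply ih (D.glue (D.opp h))
    rw [e2, D.glue_glue]

/-- Every link diagram can be oriented. -/
instance : Nonempty D.Orientation := by
  classical
  let p : Equiv.Perm D.End :=
    ⟨fun x => D.glue (D.opp x), fun x => D.opp (D.glue x),
      fun x => by simp [D.glue_glue, opp_opp], fun x => by simp [D.glue_glue, opp_opp]⟩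
  have hp : ∀ x, p x = D.glue (D.opp x) := fun _ => rfl
  have hpi : ∀ x, p⁻¹ x = D.opp (D.glue x) := fun _ => rfl
  have hpn : ∀ (n : ℕ) x, (p ^ n) x = (fun x => D.glue (D.opp x))^[n] x := by
    intro n x
    rw [← Equiv.Perm.iterate_eq_pow]
    rfl
  -- a strand never returns with the opposite direction
  have hne : ∀ x, ¬ p.SameCycle x (D.glue x) := by
    rintro x ⟨n, hn⟩
    obtain ⟨m, rfl | rfl⟩ := n.eq_nat_or_neg
    · rw [zpow_natCast, hpn] at hn
      exact glue_ne_iterate m x hn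
    · rw [zpow_neg, Equiv.Perm.inv_eq_iff_eq, zpow_natCast, hpn] at hn
      exact glue_ne_iterate m (D.glue x) (by rw [← hn, D.glue_glue])
  have hg1 : ∀ x y, p.SameCycle x y → p.SameCycle (D.glue x) (D.glue y) := by
    have hs : ∀ x, p.SameCycle (D.glue x) (D.glue (p x)) := by
      intro x
      refine ⟨-1, ?_⟩
      rw [zpow_neg_one, hpi, hp, D.glue_glue, D.glue_glue]
    have hz : ∀ (n : ℤ) x, p.SameCycle (D.glue x) (D.glue ((p ^ n) x)) := by
      intro n x
      induction n using Int.induction_on with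
      | zero => exact Equiv.Perm.SameCycle.refl _ _
      | succ n ih =>
        rw [add_comm, zpow_add, zpow_one, Equiv.Perm.mul_apply]
        exact ih.trans (hs _)
      | pred n ih =>
        refine ih.trans ?_
        have := hs ((p ^ (-(n : ℤ) - 1)) x)
        rw [← Equiv.Perm.mul_apply, ← zpow_one_add] at this
        rw [show (1 : ℤ) + (-(n : ℤ) - 1) = -n by ring] at this
        exact this.symm
    rintro x y ⟨n, rfl⟩
    exact hz n x
  have hcomp : ∀ x y : D.End, D.component x = D.component y →
      p.SameCycle x y ∨ p.SameCycle x (D.glue y) := by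
    intro x y h
    have h' := Quot.eqvGen_exact h
    clear h
    induction h' with
    | rel x y h =>
      rcases h with rfl | rfl
      · right; rw [D.glue_glue]
      · right; exact ⟨1, rfl⟩
    | refl x => exact Or.inl (Equiv.Perm.SameCycle.refl _ _)
    | symm x y _ ih =>
      rcases ih with h | h
      · exact Or.inl h.symm
      · right
        have := hg1 _ _ h
        rw [D.glue_glue] at this
        exact this.symm
    | trans x y z _ _ ih1 ih2 =>
      rcases ih1 with h | h <;>
        rcases ih2 with h' | h'
      · exact Or.inl (h.trans h')
      · exact Or.inr (h.trans h')
      · exact Or.inr (h.trans (hg1 _ _ h'))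
      · left
        have := hg1 _ _ h'
        rw [D.glue_glue] at this
        exact h.trans this
  let rep : D.End → D.End := fun x => (Quot.exists_rep (D.component x)).choose
  have hrep : ∀ x, D.component (rep x) = D.component x :=
    fun x => (Quot.exists_rep (D.component x)).choose_spec
  have hcg : ∀ x, rep (D.glue x) = rep x := by
    intro x
    have : D.component x = D.component (D.glue x) := Quot.sound (Or.inl rfl)
    simp only [rep, this]
  have hco : ∀ x, rep (D.opp x) = rep x := by
    intro x
    have : D.component x = D.component (D.opp x) := Quot.sound (Or.inr rfl)
    simp only [rep, this]
  have hglue : ∀ x, decide (p.SameCycle (rep (D.glue x)) (D.glue x)) =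
      !decide (p.SameCycle (rep x) x) := by
    intro x
    rw [hcg]
    by_cases h : p.SameCycle (rep x) x
    · have : ¬ p.SameCycle (rep x) (D.glue x) := fun h' => hne x (h.symm.trans h')
      simp [h, this]
    · have := (hcomp _ _ (hrep x)).resolve_left h
      simp [h, this]
  refine ⟨⟨fun x => decide (p.SameCycle (rep x) x), hglue, fun x => ?_⟩⟩
  have h1 := hglue (D.opp x)
  have h2 : p.SameCycle (rep (D.glue (D.opp x))) (D.glue (D.opp x)) ↔
      p.SameCycle (rep x) x := by
    rw [hcg, hco, ← hp, Equiv.Perm.sameCycle_apply_right]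
  rw [decide_eq_decide.mpr h2] at h1
  rw [h1, Bool.not_not]

variable (D) in
/-- The ring `ℤ[t_c, t_c⁻¹]` of Laurent polynomials with one variable for each component `c`,
as the group ring of the free abelian group on the components. -/
abbrev LaurentRing : Type := MonoidAlgebra ℤ (Multiplicative (D.Component →₀ ℤ))

variable (D) in
/-- The homomorphism from the free group on the arcs to the first homology of the link complement
(free abelian on the meridians `t_c` of the components), sending the meridian of an arc to the
meridian of its component. -/
def meridianMap : FreeGroup D.Arc →* Multiplicative (D.Component →₀ ℤ) :=
  FreeGroup.lift fun x => Multiplicative.ofAdd (Finsupp.single (D.arcComponent x) 1)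

namespace Orientation

variable (o : D.Orientation)

/-- The end through which the upper strand enters the crossing `c`. -/
def overIn (c : D.Crossing) : Fin 4 :=
  if o.incoming (c, D.upper c) then D.upper c else D.upper c + 2

/-- The Wirtinger relator `x_k x_l x_k⁻¹ x_r⁻¹` at the crossing `c`, where `k` is the upper arc and
`l` and `r` are the lower arcs to the left and to the right of it. Counterclockwise from the end
where the upper strand enters, the next end lies to its right and the last one to its left. -/
def wirtingerRelator (c : D.Crossing) : FreeGroup D.Arc :=
  let k := FreeGroup.of (D.arc (c, o.overIn c))
  let r := FreeGroup.of (D.arc (c, o.overIn c + 1))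
  let l := FreeGroup.of (D.arc (c, o.overIn c + 3))
  k * l * k⁻¹ * r⁻¹

open Classical in
/-- The Alexander matrix: the Fox Jacobian of the Wirtinger presentation of the link group over
the group ring of the first homology of the link complement. -/
def alexanderMatrix : Matrix D.Crossing D.Arc D.LaurentRing :=
  Fox.jacobian o.wirtingerRelator D.meridianMap

/-- `Δ` is a multivariable Alexander polynomial of the oriented link: a greatest common divisor of
the first elementary ideal of the Alexander matrix. -/
def IsAlexanderPolynomial (Δ : D.LaurentRing) : Prop :=
  ∀ d : D.LaurentRing, d ∣ Δ ↔ ∀ m ∈ elementaryIdeal o.alexanderMatrix 1, d ∣ m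

end Orientation

end LinkDiagram

/-! ## Pretzel links -/

namespace Pretzel

variable {n : ℕ} (a : Fin n → ℤ)

/-- The crossings of the pretzel diagram: the `i`-th column is a vertical two-strand braid with
`|a i|` crossings, which are numbered from top to bottom. -/
abbrev Crossing : Type := Σ i : Fin n, Fin (a i).natAbs

variable (ha : ∀ i, a i ≠ 0)

/-- The first crossing of a column. -/
def top (i : Fin n) : Crossing a := ⟨i, 0, Int.natAbs_pos.mpr (ha i)⟩

/-- The last crossing of a column. -/
def bottom (i : Fin n) : Crossing a :=
  ⟨i, (a i).natAbs - 1, Nat.sub_lt (Int.natAbs_pos.mpr (ha i)) one_pos⟩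

/-- The edges of the pretzel diagram. The ends `0, 1, 2, 3` of a crossing are the upper right,
upper left, lower left and lower right ones. Successive crossings of a column are joined on both
sides; at the top and at the bottom, bridges join the right strand of each column to the left
strand of the cyclically next one. -/
def glue : Crossing a × Fin 4 → Crossing a × Fin 4
  | (⟨i, k⟩, 0) =>
      if k.val = 0 then (top a ha (finRotate n i), 1) else (⟨i, k.val - 1, by omega⟩, 3)
  | (⟨i, k⟩, 1) =>
      if k.val = 0 then (top a ha ((finRotate n).symm i), 0) else (⟨i, k.val - 1, by omega⟩, 2)
  | (⟨i, k⟩, 2) =>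
      if h : k.val + 1 < (a i).natAbs then (⟨i, k.val + 1, h⟩, 1)
      else (bottom a ha ((finRotate n).symm i), 3)
  | (⟨i, k⟩, 3) =>
      if h : k.val + 1 < (a i).natAbs then (⟨i, k.val + 1, h⟩, 0)
      else (bottom a ha (finRotate n i), 2)

theorem top_eq (i : Fin n) (k : Fin (a i).natAbs) (hk : k.val = 0) :
    top a ha i = ⟨i, k⟩ := by
  simp only [top, Sigma.mk.injEq, heq_eq_eq, true_and]
  exact Fin.ext hk.symm

theorem bottom_eq (i : Fin n) (k : Fin (a i).natAbs) (hk : ¬ k.val + 1 < (a i).natAbs) :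
    bottom a ha i = ⟨i, k⟩ := by
  simp only [bottom, Sigma.mk.injEq, heq_eq_eq, true_and]
  apply Fin.ext
  have := k.isLt
  simp only
  omega

theorem glue_top_zero (i : Fin n) :
    glue a ha (top a ha i, 0) = (top a ha (finRotate n i), 1) := by
  conv_lhs => rw [top, glue]
  exact if_pos rfl

theorem glue_top_one (i : Fin n) :
    glue a ha (top a ha i, 1) = (top a ha ((finRotate n).symm i), 0) := by
  conv_lhs => rw [top, glue]
  exact if_pos rfl

theorem glue_bottom_two (i : Fin n) :
    glue a ha (bottom a ha i, 2) = (bottom a ha ((finRotate n).symm i), 3) := by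
  conv_lhs => rw [bottom, glue]
  have := Int.natAbs_pos.mpr (ha i)
  exact dif_neg (by simp only; omega)

theorem glue_bottom_three (i : Fin n) :
    glue a ha (bottom a ha i, 3) = (bottom a ha (finRotate n i), 2) := by
  conv_lhs => rw [bottom, glue]
  have := Int.natAbs_pos.mpr (ha i)
  exact dif_neg (by simp only; omega)

theorem glue_glue (h : Crossing a × Fin 4) : glue a ha (glue a ha h) = h := by
  obtain ⟨⟨i, k⟩, e⟩ := h
  have hk := k.isLt
  match e with
  | 0 =>
    by_cases h0 : k.val = 0
    · rw [← top_eq a ha i k h0, glue_top_zero, glue_top_one, Equiv.symm_apply_apply]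
    · have h1 : k.val - 1 + 1 = k.val := by omega
      simp [glue, h0, h1]
  | 1 =>
    by_cases h0 : k.val = 0
    · rw [← top_eq a ha i k h0, glue_top_one, glue_top_zero, Equiv.apply_symm_apply]
    · have h1 : k.val - 1 + 1 = k.val := by omega
      simp [glue, h0, h1]
  | 2 =>
    by_cases h0 : k.val + 1 < (a i).natAbs
    · simp [glue, h0]
    · rw [← bottom_eq a ha i k h0, glue_bottom_two, glue_bottom_three, Equiv.apply_symm_apply]
  | 3 =>
    by_cases h0 : k.val + 1 < (a i).natAbs
    · simp [glue, h0]
    · rw [← bottom_eq a ha i k h0, glue_bottom_three, glue_bottom_two, Equiv.symm_apply_apply]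

theorem glue_ne (h : Crossing a × Fin 4) : glue a ha h ≠ h := by
  obtain ⟨⟨i, k⟩, e⟩ := h
  intro he
  have h2 := congrArg Prod.snd he
  match e with
  | 0 => simp only [glue] at h2; split at h2 <;> simp at h2
  | 1 => simp only [glue] at h2; split at h2 <;> simp at h2
  | 2 => simp only [glue] at h2; split at h2 <;> simp at h2
  | 3 => simp only [glue] at h2; split at h2 <;> simp at h2

end Pretzel

/-- The standard diagram of the pretzel link `P(a₁, …, aₙ)` with nonzero coefficients. In a column
with `a i > 0` the strand from the upper left to the lower right is the upper one at every
crossing, in a column with `a i < 0` the strand from the upper right to the lower left. -/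
def pretzelLink {n : ℕ} (a : Fin n → ℤ) (ha : ∀ i, a i ≠ 0) : LinkDiagram where
  Crossing := Pretzel.Crossing a
  finite_crossing := inferInstance
  upper c := if 0 < a c.1 then 1 else 0
  glue := Pretzel.glue a ha
  glue_glue := Pretzel.glue_glue a ha
  glue_ne := Pretzel.glue_ne a ha

/-- The coefficients `(-2r-1, 2q, -2q, 2r+1)`. -/
def symmetricCoeffs (q r : ℕ) : Fin 4 → ℤ := ![-2 * r - 1, 2 * q, -2 * q, 2 * r + 1]

theorem symmetricCoeffs_ne_zero {q : ℕ} (hq : 0 < q) (r : ℕ) (i : Fin 4) :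
    symmetricCoeffs q r i ≠ 0 := by
  fin_cases i <;> simp [symmetricCoeffs] <;> omega

/-- The symmetric pretzel link `P_{q,r} = P(-2r-1, 2q, -2q, 2r+1)`. -/
def symmetricPretzelLink (q r : ℕ) (hq : 0 < q) : LinkDiagram :=
  pretzelLink (symmetricCoeffs q r) (symmetricCoeffs_ne_zero hq r)

end

/-! The reflection in the vertical line between the two middle columns reverses the order of the
columns and negates their coefficients, so it carries the diagram to itself, upper strands to upper
strands. The axis is crossed only by bridges, and because the outer columns are odd every component
runs through such a bridge (`forall_end_of_bridges`). Hence the reflection preserves each component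
and reverses its direction. Left and right are then exchanged twice, once by the reflection and once
by the reversal, so the linearized Wirtinger relation at a crossing becomes, with the same
coefficients, the one at its mirror image.

A colouring of the left half of the diagram therefore extends symmetrically to the whole, and it
automatically matches along the bridges over the axis. The left half has three free colours at the
top. Meridians being units, each crossing determines the colours below it from those above, and the
only equation left is the one at the bottom bridge between columns `0` and `1`. One may also require
the colour of a prescribed arc to vanish: two linear equations in three unknowns have a nonzero
solution (`exists_coloring`).

Colourings are kernel vectors of the Alexander matrix. A nonzero one that vanishes at an arc is a
relation between the remaining columns, so all minors omitting that column are zero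
(`elementaryIdeal_one_eq_bot`). -/

noncomputable section

/-! ### Fox derivatives as crossed homomorphisms -/

namespace Fox

variable {α G : Type*} [DecidableEq α] [Group G]

theorem deriv_one (a : α) : deriv a (1 : FreeGroup α) = 0 := rfl

/-- The crossed homomorphism `w ↦ ∑ₐ φ(∂w/∂xₐ) vₐ` with values `vₐ` on the generators. -/
def crossedHom [Fintype α] (φ : FreeGroup α →* G) (v : α → MonoidAlgebra ℤ G)
    (w : FreeGroup α) : MonoidAlgebra ℤ G :=
  ∑ a, MonoidAlgebra.mapDomainRingHom ℤ φ (deriv a w) * v a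

variable [Fintype α] (φ : FreeGroup α →* G) (v : α → MonoidAlgebra ℤ G)

theorem crossedHom_of (b : α) : crossedHom φ v (FreeGroup.of b) = v b := by
  simp only [crossedHom, deriv_of]
  rw [Finset.sum_eq_single b]
  · simp
  · intro a _ h
    simp [h.symm]
  · simp

/-- This product rule expands a row of the Jacobian applied to `v` along the relator, with no case
distinction on whether some of its letters coincide. -/
theorem crossedHom_mul (u w : FreeGroup α) :
    crossedHom φ v (u * w) =
      crossedHom φ v u + MonoidAlgebra.of ℤ G (φ u) * crossedHom φ v w := by
  simp only [crossedHom, deriv_mul, map_add, map_mul, add_mul, Finset.sum_add_distrib,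
    Finset.mul_sum, mul_assoc]
  simp

theorem crossedHom_inv (u : FreeGroup α) :
    crossedHom φ v u⁻¹ = -(MonoidAlgebra.of ℤ G (φ u)⁻¹ * crossedHom φ v u) := by
  have h := crossedHom_mul φ v u⁻¹ u
  rw [inv_mul_cancel, map_inv] at h
  have h1 : crossedHom φ v 1 = 0 := by simp [crossedHom, deriv_one]
  rw [h1] at h
  exact eq_neg_of_add_eq_zero_left h.symm

end Fox

/-- The first elementary ideal vanishes if every column admits a nonzero relation between the
columns of the matrix not involving it. -/
theorem elementaryIdeal_one_eq_bot {ι κ R : Type*} [CommRing R] [IsDomain R] [Fintype κ]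
    [Nonempty κ] (A : Matrix ι κ R)
    (h : ∀ x, ∃ v : κ → R, v ≠ 0 ∧ v x = 0 ∧ A.mulVec v = 0) : elementaryIdeal A 1 = ⊥ := by
  classical
  rw [elementaryIdeal, Ideal.span_eq_bot]
  rintro _ ⟨f, g, rfl⟩
  by_cases hg : Function.Injective g
  · have hpos : 0 < Nat.card κ := Nat.card_pos
    -- An injective `g` omits exactly one column `x`, since it selects one fewer than there are.
    have hns : ¬ Function.Surjective g := by
      intro hs
      have := Nat.card_congr (Equiv.ofBijective g ⟨hg, hs⟩)
      simp only [Nat.card_eq_fintype_card, Fintype.card_fin] at this hpos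
      omega
    rw [Function.Surjective] at hns
    push Not at hns
    obtain ⟨x, hx⟩ := hns
    have himg : Finset.univ.image g = Finset.univ.erase x := by
      apply Finset.eq_of_subset_of_card_le
      · intro y hy
        obtain ⟨j, -, rfl⟩ := Finset.mem_image.mp hy
        exact Finset.mem_erase.mpr ⟨hx j, Finset.mem_univ _⟩
      · rw [Finset.card_image_of_injective _ hg, Finset.card_erase_of_mem (Finset.mem_univ _)]
        simp [Nat.card_eq_fintype_card]
    obtain ⟨v, hv, hvx, hAv⟩ := h x
    -- As `v x = 0`, the restriction of `v` to the selected columns is still a nonzero kernel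
    -- vector, and over a domain this kills the determinant.
    rw [← Matrix.exists_mulVec_eq_zero_iff]
    refine ⟨v ∘ g, ?_, ?_⟩
    · intro h0
      apply hv
      funext y
      by_cases hy : y = x
      · rw [hy, hvx, Pi.zero_apply]
      · have : y ∈ Finset.univ.image g := by
          rw [himg]
          exact Finset.mem_erase.mpr ⟨hy, Finset.mem_univ _⟩
        obtain ⟨j, -, rfl⟩ := Finset.mem_image.mp this
        exact congrFun h0 j
    · funext i
      have h1 := congrFun hAv (f i)
      simp only [Matrix.mulVec, dotProduct, Pi.zero_apply] at h1
      rw [← Finset.add_sum_erase _ _ (Finset.mem_univ x), hvx, mul_zero, zero_add, ← himg,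
        Finset.sum_image hg.injOn] at h1
      exact h1
  · simp only [Function.Injective] at hg
    push Not at hg
    obtain ⟨j, j', e, hne⟩ := hg
    exact Matrix.det_zero_of_column_eq hne fun i => by simp [e]

/-! ### Colourings as kernel vectors of the Alexander matrix -/

namespace LinkDiagram

variable {D : LinkDiagram}

instance : Finite D.Crossing := D.finite_crossing

instance : Finite D.Arc := Quot.finite _

/-- The meridian `t_c` of the component of an end. -/
def meridian (h : D.End) : D.LaurentRing :=
  MonoidAlgebra.of ℤ _ (Multiplicative.ofAdd (Finsupp.single (D.component h) 1))

theorem isUnit_meridian (h : D.End) : IsUnit (D.meridian h) :=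
  (Group.isUnit _).map (MonoidAlgebra.of ℤ (Multiplicative (D.Component →₀ ℤ)))

theorem component_glue (h : D.End) : D.component (D.glue h) = D.component h :=
  Eq.symm <| Quot.sound (r := fun h h' : D.End => h' = D.glue h ∨ h' = D.opp h) (Or.inl rfl)

theorem component_opp (h : D.End) : D.component (D.opp h) = D.component h :=
  Eq.symm <| Quot.sound (r := fun h h' : D.End => h' = D.glue h ∨ h' = D.opp h) (Or.inr rfl)

namespace Orientation

variable (o : D.Orientation)

/-- A colouring of the ends that is constant on arcs and is annihilated by the linearized
Wirtinger relations. -/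
structure IsColoring (f : D.End → D.LaurentRing) : Prop where
  glue : ∀ h, f (D.glue h) = f h
  opp : ∀ h, D.IsOver h → f (D.opp h) = f h
  crossing : ∀ c, (1 - D.meridian (c, o.overIn c + 3)) * f (c, o.overIn c) +
    D.meridian (c, o.overIn c) * f (c, o.overIn c + 3) = f (c, o.overIn c + 1)

variable {o}

/-- The values of a colouring on arcs. -/
def IsColoring.onArcs {f : D.End → D.LaurentRing} (hf : o.IsColoring f) : D.Arc → D.LaurentRing :=
  Quot.lift f fun x y h => by
    rcases h with rfl | ⟨h, rfl⟩
    · exact (hf.glue x).symm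
    · exact (hf.opp x h).symm

theorem IsColoring.mulVec_onArcs [Fintype D.Arc] {f : D.End → D.LaurentRing}
    (hf : o.IsColoring f) : o.alexanderMatrix.mulVec hf.onArcs = 0 := by
  classical
  funext c
  have hcr := hf.crossing c
  have key : o.alexanderMatrix.mulVec hf.onArcs c =
      Fox.crossedHom D.meridianMap hf.onArcs (o.wirtingerRelator c) := by
    simp only [Matrix.mulVec, dotProduct, alexanderMatrix, Fox.jacobian, Fox.crossedHom,
      Matrix.of_apply]
  have hm : ∀ e, D.meridianMap (FreeGroup.of (D.arc e)) =
      Multiplicative.ofAdd (Finsupp.single (D.component e) 1) := fun e => by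
    rw [meridianMap, FreeGroup.lift_apply_of]
    rfl
  -- Both lower arcs lie on one component, so the relator maps to `1` in homology and the right-hand
  -- arc gets the coefficient `-1`.
  have hc : D.component (c, o.overIn c + 1) = D.component (c, o.overIn c + 3) := by
    rw [← component_opp (c, o.overIn c + 1)]
    simp [LinkDiagram.opp, add_assoc]
  have hv : ∀ e, hf.onArcs (D.arc e) = f e := fun _ => rfl
  rw [key, wirtingerRelator]
  simp only [Fox.crossedHom_mul, Fox.crossedHom_inv, Fox.crossedHom_of, hv, map_mul, map_inv, hm,
    hc, Pi.zero_apply]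
  rw [← hcr]
  simp only [meridian]
  generalize hK : Multiplicative.ofAdd (Finsupp.single (D.component (c, o.overIn c)) (1 : ℤ)) = K
  generalize hL :
    Multiplicative.ofAdd (Finsupp.single (D.component (c, o.overIn c + 3)) (1 : ℤ)) = L
  have hK1 : MonoidAlgebra.of ℤ _ K * MonoidAlgebra.of ℤ _ K⁻¹ = 1 := by
    rw [← map_mul, mul_inv_cancel, map_one]
  have hL1 : MonoidAlgebra.of ℤ _ L * MonoidAlgebra.of ℤ _ L⁻¹ = 1 := by
    rw [← map_mul, mul_inv_cancel, map_one]
  generalize MonoidAlgebra.of ℤ _ K = A at *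
  generalize MonoidAlgebra.of ℤ _ K⁻¹ = A' at *
  generalize MonoidAlgebra.of ℤ _ L = B at *
  generalize MonoidAlgebra.of ℤ _ L⁻¹ = B' at *
  generalize f (c, o.overIn c) = x
  generalize f (c, o.overIn c + 3) = y
  linear_combination (-B * x - B * B' * ((1 - B) * x + A * y)) * hK1 -
    ((1 - B) * x + A * y) * hL1

theorem isAlexanderPolynomial_iff_eq_zero (e : D.End)
    (h : ∀ e : D.End, ∃ f, o.IsColoring f ∧ f ≠ 0 ∧ f e = 0) (Δ : D.LaurentRing) :
    o.IsAlexanderPolynomial Δ ↔ Δ = 0 := by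
  have : Fintype D.Arc := Fintype.ofFinite _
  have : Nonempty D.Arc := ⟨D.arc e⟩
  have hbot : elementaryIdeal o.alexanderMatrix 1 = ⊥ := by
    refine elementaryIdeal_one_eq_bot _ fun x => ?_
    induction x using Quot.inductionOn with
    | _ x =>
      obtain ⟨f, hf, hne, hx⟩ := h x
      exact ⟨hf.onArcs, fun h0 => hne (funext fun y => congrFun h0 (D.arc y)), hx,
        hf.mulVec_onArcs⟩
  constructor
  · intro hΔ
    -- The defining property of the greatest common divisor is used for the divisor `0`, which
    -- divides every element of the zero ideal.
    refine zero_dvd_iff.mp ((hΔ 0).mpr fun m hm => ?_)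
    rw [hbot, Ideal.mem_bot] at hm
    rw [hm]
  · rintro rfl d
    refine ⟨fun _ m hm => ?_, fun _ => dvd_zero d⟩
    rw [hbot, Ideal.mem_bot] at hm
    rw [hm]
    exact dvd_zero d

end Orientation

end LinkDiagram

/-- A two-strand crossing with lower meridian `b` and upper meridian `τ`: where the colours
of the two top ends determine those of the two bottom ends. -/
theorem exists_crossing_transfer {R : Type*} [CommRing R] (τ b : R) (hτ : IsUnit τ) (u k : Fin 4)
    (hu : u = 0 ∨ u = 1) (hk : k = u ∨ k = u + 2) :
    ∃ S : R × R →ₗ[R] R × R, ∀ p : R × R, ∀ c : Fin 4 → R,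
      c = ![p.2, p.1, (S p).1, (S p).2] →
        c u = c (u + 2) ∧ (1 - b) * c k + τ * c (k + 3) = c (k + 1) := by
  -- The relation expresses the right lower colour through the left one. When the left lower end is
  -- at the bottom of the crossing, solving downwards requires division by `τ`.
  obtain ⟨τ, rfl⟩ := hτ
  let F : R → R → R × R →ₗ[R] R := fun α β =>
    α • LinearMap.fst R R R + β • LinearMap.snd R R R
  have hF : ∀ α β p, F α β p = α * p.1 + β * p.2 := fun α β p => by simp [F]
  have hinv : (τ : R) * (τ⁻¹ : Rˣ) = 1 := τ.mul_inv
  rcases hu with rfl | rfl <;> rcases hk with rfl | rfl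
  · refine ⟨(F 0 1).prod (F (τ⁻¹ : Rˣ) (-(τ⁻¹ : Rˣ) * (1 - b))), ?_⟩
    rintro p c rfl
    simp [hF]
    linear_combination (p.1 - (1 - b) * p.2) * hinv
  · refine ⟨(F 0 1).prod (F τ (1 - b)), ?_⟩
    rintro p c rfl
    simp [hF]
    ring
  · refine ⟨(F (1 - b) τ).prod (F 1 0), ?_⟩
    rintro p c rfl
    simp [hF]
  · refine ⟨(F (-(τ⁻¹ : Rˣ) * (1 - b)) (τ⁻¹ : Rˣ)).prod (F 1 0), ?_⟩
    rintro p c rfl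
    simp [hF]
    linear_combination (p.2 - (1 - b) * p.1) * hinv

namespace LinkDiagram

theorem meridian_opp {D : LinkDiagram} (c : D.Crossing) (e : Fin 4) : D.meridian (c, e + 2) = D.meridian (c, e) := by
  exact congrArg (fun x => MonoidAlgebra.of ℤ _ (Multiplicative.ofAdd (Finsupp.single x 1)))
    (component_opp (c, e))

theorem Orientation.overIn_eq_or {D : LinkDiagram} (o : D.Orientation)
    (c : D.Crossing) : o.overIn c = D.upper c ∨ o.overIn c = D.upper c + 2 := by
  rw [overIn]
  split <;> simp

end LinkDiagram

/-! ### The reflection of the pretzel diagram -/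

namespace Pretzel

open LinkDiagram

theorem crossing_ext {n : ℕ} {a : Fin n → ℤ} {c d : Crossing a} (h1 : c.1 = d.1)
    (h2 : c.2.val = d.2.val) : c = d := by
  obtain ⟨i, k⟩ := c
  obtain ⟨j, l⟩ := d
  obtain rfl : i = j := h1
  exact congrArg _ (Fin.ext h2)

section

variable {n : ℕ} {a : Fin n → ℤ} {ha : ∀ i, a i ≠ 0}

theorem glue_two (i : Fin n) (k : ℕ) (hk : k + 1 < (a i).natAbs) :
    glue a ha (⟨i, k, Nat.lt_of_succ_lt hk⟩, 2) = (⟨i, k + 1, hk⟩, 1) := by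
  simp [glue, hk]

theorem glue_three (i : Fin n) (k : ℕ) (hk : k + 1 < (a i).natAbs) :
    glue a ha (⟨i, k, Nat.lt_of_succ_lt hk⟩, 3) = (⟨i, k + 1, hk⟩, 0) := by
  simp [glue, hk]

theorem glue_succ_zero (i : Fin n) (k : ℕ) (hk : k + 1 < (a i).natAbs) :
    glue a ha (⟨i, k + 1, hk⟩, 0) = (⟨i, k, Nat.lt_of_succ_lt hk⟩, 3) := by
  simp [glue]

theorem glue_succ_one (i : Fin n) (k : ℕ) (hk : k + 1 < (a i).natAbs) :
    glue a ha (⟨i, k + 1, hk⟩, 1) = (⟨i, k, Nat.lt_of_succ_lt hk⟩, 2) := by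
  simp [glue]

end

/-- The reflection of a pretzel diagram of four columns with `a₃ = -a₀` and `a₂ = -a₁` in the
vertical line between its second and third columns, on crossings. -/
def mirrorCrossing {a : Fin 4 → ℤ} (hrev : ∀ i, a i.rev = -a i) (c : Crossing a) : Crossing a :=
  ⟨c.1.rev, c.2.cast (by rw [hrev, Int.natAbs_neg])⟩

/-- The reflection of a symmetric pretzel diagram of four columns, on ends. -/
def mirror {a : Fin 4 → ℤ} (hrev : ∀ i, a i.rev = -a i) (h : Crossing a × Fin 4) :
    Crossing a × Fin 4 :=
  (mirrorCrossing hrev h.1, 1 - h.2)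

section

variable {a : Fin 4 → ℤ} (ha : ∀ i, a i ≠ 0) (hrev : ∀ i, a i.rev = -a i)

theorem mirrorCrossing_mirrorCrossing (c : Crossing a) :
    mirrorCrossing hrev (mirrorCrossing hrev c) = c :=
  crossing_ext (Fin.rev_rev _) rfl

theorem mirror_mirror (h : Crossing a × Fin 4) : mirror hrev (mirror hrev h) = h :=
  Prod.ext (mirrorCrossing_mirrorCrossing hrev h.1) (sub_sub_cancel 1 h.2)

theorem mirrorCrossing_top (i : Fin 4) : mirrorCrossing hrev (top a ha i) = top a ha i.rev :=
  crossing_ext rfl rfl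

theorem mirrorCrossing_bottom (i : Fin 4) :
    mirrorCrossing hrev (bottom a ha i) = bottom a ha i.rev :=
  crossing_ext rfl (by simp [mirrorCrossing, bottom, hrev])

theorem finRotate_rev (i : Fin 4) : finRotate 4 i.rev = ((finRotate 4).symm i).rev := by
  rw [finRotate_symm_apply, finRotate_apply]
  revert i
  decide

theorem finRotate_symm_rev (i : Fin 4) : (finRotate 4).symm i.rev = (finRotate 4 i).rev := by
  rw [finRotate_symm_apply, finRotate_apply]
  revert i
  decide

theorem mirror_add_two (c : Crossing a) (e : Fin 4) :
    mirror hrev (c, e + 2) = (mirrorCrossing hrev c, 1 - e + 2) := by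
  have h : ∀ e : Fin 4, 1 - (e + 2) = 1 - e + 2 := by decide
  exact Prod.ext rfl (h e)

theorem glue_mirror (h : Crossing a × Fin 4) :
    glue a ha (mirror hrev h) = mirror hrev (glue a ha h) := by
  obtain ⟨⟨i, k, hk⟩, e⟩ := h
  have hn : (a i.rev).natAbs = (a i).natAbs := by rw [hrev, Int.natAbs_neg]
  match e with
  | 0 =>
    cases k with
    | zero =>
      rw [← top_eq a ha i ⟨0, hk⟩ rfl, glue_top_zero, mirror, mirror, mirrorCrossing_top,
        mirrorCrossing_top, ← finRotate_symm_rev]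
      exact glue_top_one a ha i.rev
    | succ k =>
      rw [glue_succ_zero]
      exact glue_succ_one i.rev k (hn ▸ hk)
  | 1 =>
    cases k with
    | zero =>
      rw [← top_eq a ha i ⟨0, hk⟩ rfl, glue_top_one, mirror, mirror, mirrorCrossing_top,
        mirrorCrossing_top, ← finRotate_rev]
      exact glue_top_zero a ha i.rev
    | succ k =>
      rw [glue_succ_one]
      exact glue_succ_zero i.rev k (hn ▸ hk)
  | 2 =>
    by_cases h0 : k + 1 < (a i).natAbs
    · rw [glue_two i k h0]
      exact glue_three i.rev k (hn ▸ h0)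
    · rw [← bottom_eq a ha i ⟨k, hk⟩ h0, glue_bottom_two, mirror, mirror, mirrorCrossing_bottom,
        mirrorCrossing_bottom, ← finRotate_rev]
      exact glue_bottom_three a ha i.rev
  | 3 =>
    by_cases h0 : k + 1 < (a i).natAbs
    · rw [glue_three i k h0]
      exact glue_two i.rev k (hn ▸ h0)
    · rw [← bottom_eq a ha i ⟨k, hk⟩ h0, glue_bottom_three, mirror, mirror,
        mirrorCrossing_bottom, mirrorCrossing_bottom, ← finRotate_symm_rev]
      exact glue_bottom_two a ha i.rev

end

/-! ### Strands running through a column -/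

section

variable {n : ℕ} {a : Fin n → ℤ} {ha : ∀ i, a i ≠ 0} {P : Crossing a × Fin 4 → Prop}
  (hglue : ∀ h, P h → P (glue a ha h)) (hopp : ∀ c e, P (c, e) → P (c, e + 2))

include hopp in
theorem forall_end_of_zero_one {c : Crossing a} (h0 : P (c, 0)) (h1 : P (c, 1)) (e : Fin 4) :
    P (c, e) :=
  match e with
  | 0 => h0
  | 1 => h1
  | 2 => hopp c 0 h0
  | 3 => hopp c 1 h1

include hglue hopp

/-- The strands entering a column at the top cover it. -/
theorem column_of_top (i : Fin n) (h0 : P (top a ha i, 0)) (h1 : P (top a ha i, 1))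
    (k : Fin (a i).natAbs) (e : Fin 4) : P (⟨i, k⟩, e) := by
  have key : ∀ (k : ℕ) (hk : k < (a i).natAbs), P (⟨i, k, hk⟩, 0) ∧ P (⟨i, k, hk⟩, 1) := by
    intro k
    induction k with
    | zero => exact fun hk => ⟨h0, h1⟩
    | succ k ih =>
      intro hk
      obtain ⟨g0, g1⟩ := ih (Nat.lt_of_succ_lt hk)
      have g2 := hglue _ (hopp _ _ g0)
      have g3 := hglue _ (hopp _ _ g1)
      exact ⟨glue_three (ha := ha) i k hk ▸ g3, glue_two (ha := ha) i k hk ▸ g2⟩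
  exact forall_end_of_zero_one hopp (key k k.2).1 (key k k.2).2 e

/-- In a column with an odd number of crossings, the strands entering at the upper left and at the
lower left cover the column. -/
theorem column_of_left (i : Fin n) (hodd : Odd (a i)) (h1 : P (top a ha i, 1))
    (h2 : P (bottom a ha i, 2)) (k : Fin (a i).natAbs) (e : Fin 4) : P (⟨i, k⟩, e) := by
  -- The strand entering at the upper left changes sides at each crossing, so its side is given by
  -- the parity of `k`.
  have down : ∀ (k : ℕ) (hk : k < (a i).natAbs),
      (Even k → P (⟨i, k, hk⟩, 1)) ∧ (Odd k → P (⟨i, k, hk⟩, 0)) := by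
    intro k
    induction k with
    | zero => exact fun hk => ⟨fun _ => h1, fun h => absurd h (by simp)⟩
    | succ k ih =>
      intro hk
      obtain ⟨g1, g0⟩ := ih (Nat.lt_of_succ_lt hk)
      refine ⟨fun h => ?_, fun h => ?_⟩
      · have := hglue _ (hopp _ _ (g0 (by grind)))
        exact glue_two (ha := ha) i k hk ▸ this
      · have := hglue _ (hopp _ _ (g1 (by grind)))
        exact glue_three (ha := ha) i k hk ▸ this
  have hodd' : Odd (a i).natAbs := Int.natAbs_odd.mpr hodd
  -- The same for the strand entering at the lower left, where `j` counts the crossings below the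
  -- `k`-th one.
  have up : ∀ (j k : ℕ) (hk : k < (a i).natAbs), j + k + 1 = (a i).natAbs →
      (Even j → P (⟨i, k, hk⟩, 2)) ∧ (Odd j → P (⟨i, k, hk⟩, 3)) := by
    intro j
    induction j with
    | zero =>
      intro k hk hj
      refine ⟨fun _ => ?_, fun h => absurd h (by simp)⟩
      have hb : bottom a ha i = ⟨i, k, hk⟩ := bottom_eq a ha i ⟨k, hk⟩ (by simp only; omega)
      rwa [hb] at h2
    | succ j ih =>
      intro k hk hj
      have hk' : k + 1 < (a i).natAbs := by omega
      obtain ⟨g2, g3⟩ := ih (k + 1) hk' (by omega)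
      refine ⟨fun h => ?_, fun h => ?_⟩
      · have := hglue _ (hopp _ _ (g3 (by grind)))
        exact glue_succ_one (ha := ha) i k hk' ▸ this
      · have := hglue _ (hopp _ _ (g2 (by grind)))
        exact glue_succ_zero (ha := ha) i k hk' ▸ this
  obtain ⟨d1, d0⟩ := down k k.2
  obtain ⟨u2, u3⟩ := up ((a i).natAbs - 1 - k) k k.2 (by have := k.2; omega)
  have hk := k.2
  -- The number of crossings being odd, `j` and `k` have the same parity; hence the two strands meet
  -- the crossing in different strands and cover all its ends.
  rcases Nat.even_or_odd k.val with h | h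
  · exact forall_end_of_zero_one hopp (hopp _ _ (u2 (by grind))) (d1 h) e
  · exact forall_end_of_zero_one hopp (d0 h) (hopp _ _ (u3 (by grind))) e

end

/-! ### Action of the reflection on components and orientations -/

section

variable {a : Fin 4 → ℤ} {ha : ∀ i, a i ≠ 0} (hrev : ∀ i, a i.rev = -a i)

/-- Every component of a symmetric pretzel link with odd outer columns crosses the axis of
symmetry. -/
theorem forall_end_of_bridges (hodd : Odd (a 0)) {P : Crossing a × Fin 4 → Prop}
    (hglue : ∀ h, P h → P (glue a ha h)) (hopp : ∀ c e, P (c, e) → P (c, e + 2))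
    (hmirror : ∀ h, P h → P (mirror hrev h))
    (hbridge : ∀ h, glue a ha h = mirror hrev h → P h) (h : Crossing a × Fin 4) : P h := by
  -- Both left-hand outer ends of column `0` lie on bridges to column `3`, which cross the axis.
  have c0 : ∀ k e, P (⟨0, k⟩, e) := by
    refine column_of_left (ha := ha) hglue hopp 0 hodd (hbridge _ ?_) (hbridge _ ?_)
    · rw [glue_top_one, mirror, mirrorCrossing_top, finRotate_symm_apply]
      rfl
    · rw [glue_bottom_two, mirror, mirrorCrossing_bottom, finRotate_symm_apply]
      rfl
  -- At the top, column `1` is joined to column `0` on its left and to its mirror image on its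
  -- right.
  have c1 : ∀ k e, P (⟨1, k⟩, e) := by
    refine column_of_top (ha := ha) hglue hopp 1 (hbridge _ ?_) ?_
    · rw [glue_top_zero, mirror, mirrorCrossing_top, finRotate_apply]
      rfl
    · have := hglue _ (c0 (top a ha 0).2 0)
      rw [show (⟨0, (top a ha 0).2⟩ : Crossing a) = top a ha 0 from rfl, glue_top_zero,
        finRotate_apply] at this
      exact this
  obtain ⟨⟨i, k⟩, e⟩ := h
  match i, k with
  | 0, k => exact c0 k e
  | 1, k => exact c1 k e
  | 2, k =>
    rw [← mirror_mirror hrev (_, e)]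
    exact hmirror _ (c1 _ _)
  | 3, k =>
    rw [← mirror_mirror hrev (_, e)]
    exact hmirror _ (c0 _ _)

theorem component_mirror (hodd : Odd (a 0)) (h : Crossing a × Fin 4) :
    (pretzelLink a ha).component (mirror hrev h) = (pretzelLink a ha).component h := by
  refine forall_end_of_bridges (ha := ha) hrev hodd (P := fun h =>
    (pretzelLink a ha).component (mirror hrev h) = (pretzelLink a ha).component h) ?_ ?_ ?_ ?_ h
  · intro h ih
    rw [← glue_mirror ha]
    exact (component_glue (D := pretzelLink a ha) _).trans
      (ih.trans (component_glue (D := pretzelLink a ha) _).symm)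
  · intro c e ih
    have := (component_opp (D := pretzelLink a ha) _).trans
      (ih.trans (component_opp (D := pretzelLink a ha) _).symm)
    rw [mirror_add_two]
    exact this
  · intro h ih
    rw [mirror_mirror, ih]
  · intro h ih
    rw [← ih]
    exact component_glue (D := pretzelLink a ha) h

/-- The two ends of a bridge over the axis are mirror images with opposite directions, and this
reversal propagates along each component. -/
theorem incoming_mirror (hodd : Odd (a 0)) (o : (pretzelLink a ha).Orientation)
    (h : Crossing a × Fin 4) : o.incoming (mirror hrev h) = !o.incoming h := by
  refine forall_end_of_bridges (ha := ha) hrev hodd (P := fun h =>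
    o.incoming (mirror hrev h) = !o.incoming h) ?_ ?_ ?_ ?_ h
  · intro h ih
    rw [← glue_mirror ha]
    have h1 := o.incoming_glue (mirror hrev h)
    have h2 := o.incoming_glue h
    exact h1.trans (congrArg Bool.not (ih.trans h2.symm))
  · intro c e ih
    have h1 := o.incoming_opp (mirror hrev (c, e))
    have h2 := o.incoming_opp (c, e)
    have := h1.trans (congrArg Bool.not (ih.trans h2.symm))
    rw [mirror_add_two]
    exact this
  · intro h ih
    rw [mirror_mirror, ih, Bool.not_not]
  · intro h ih
    rw [← ih]
    exact o.incoming_glue h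

theorem upper_mirrorCrossing (c : Crossing a) : (pretzelLink a ha).upper (mirrorCrossing hrev c) =
    1 - (pretzelLink a ha).upper c := by
  simp only [pretzelLink, mirrorCrossing, hrev]
  have := ha c.1
  split <;> split <;> first | rfl | omega

/-- Directions being reversed, the upper strand enters the mirror crossing at the image of its exit:
`3 - x = 1 - (x + 2)`. -/
theorem overIn_mirrorCrossing (hodd : Odd (a 0)) (o : (pretzelLink a ha).Orientation)
    (c : Crossing a) : o.overIn (mirrorCrossing hrev c) = 3 - o.overIn c := by
  have h : o.incoming (mirrorCrossing hrev c, (pretzelLink a ha).upper (mirrorCrossing hrev c)) =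
      !o.incoming (c, (pretzelLink a ha).upper c) := by
    rw [upper_mirrorCrossing]
    exact incoming_mirror hrev hodd o (c, (pretzelLink a ha).upper c)
  have hdef : ∀ c, o.overIn c = if o.incoming (c, (pretzelLink a ha).upper c) then
    (pretzelLink a ha).upper c else (pretzelLink a ha).upper c + 2 := fun _ => rfl
  rw [hdef c, hdef (mirrorCrossing hrev c), h, upper_mirrorCrossing]
  cases o.incoming (c, (pretzelLink a ha).upper c) <;>
  · generalize (pretzelLink a ha).upper c = u
    revert u
    decide

end

/-! ### Symmetric colourings built from the top downwards -/

section

theorem rev_lt_two_iff (i : Fin 4) : i.rev < 2 ↔ ¬ i < 2 := by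
  revert i
  decide

variable {R : Type*} [CommRing R] (S : Fin 4 → ℕ → (R × R →ₗ[R] R × R))

/-- The colours of the two strands above the `k`-th crossing of column `0` or `1`, as functions of
the colours at the top of the diagram, when `S i k` is the effect of the `k`-th crossing. -/
def strandColors (i : Fin 4) : ℕ → ((Fin 3 → R) →ₗ[R] R × R)
  | 0 => if i = 0 then (LinearMap.proj 0).prod (LinearMap.proj 1)
      else (LinearMap.proj 1).prod (LinearMap.proj 2)
  | k + 1 => S i k ∘ₗ strandColors i k

/-- The colours of the ends of the `k`-th crossing of column `0` or `1`. -/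
def crossingColors (i : Fin 4) (k : ℕ) (e : Fin 4) : (Fin 3 → R) →ₗ[R] R :=
  ![LinearMap.snd R R R ∘ₗ strandColors S i k, LinearMap.fst R R R ∘ₗ strandColors S i k,
    LinearMap.fst R R R ∘ₗ strandColors S i (k + 1),
    LinearMap.snd R R R ∘ₗ strandColors S i (k + 1)] e

theorem crossingColors_apply (i : Fin 4) (k : ℕ) (w : Fin 3 → R) :
    (fun e => crossingColors S i k e w) =
      ![(strandColors S i k w).2, (strandColors S i k w).1, (S i k (strandColors S i k w)).1,
        (S i k (strandColors S i k w)).2] := by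
  funext e
  match e with
  | 0 => rfl
  | 1 => rfl
  | 2 => rfl
  | 3 => rfl

variable {a : Fin 4 → ℤ}

/-- The symmetric extension of `crossingColors` to all ends of a pretzel diagram. -/
def symmetricColors (h : Crossing a × Fin 4) : (Fin 3 → R) →ₗ[R] R :=
  if h.1.1 < 2 then crossingColors S h.1.1 h.1.2 h.2
  else crossingColors S h.1.1.rev h.1.2 (1 - h.2)

theorem symmetricColors_mirror (hrev : ∀ i, a i.rev = -a i) (h : Crossing a × Fin 4) :
    symmetricColors S (mirror hrev h) = symmetricColors S h := by
  obtain ⟨⟨i, k⟩, e⟩ := h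
  by_cases hi : i < 2 <;> simp [symmetricColors, mirror, mirrorCrossing, hi, rev_lt_two_iff]

/-- Edges within a column match by construction, bridges over the axis by symmetry, and the top
bridge between columns `0` and `1` because both read the parameter `w 1`. Only the bottom bridge
between them needs the hypothesis `hw`. -/
theorem symmetricColors_glue {ha : ∀ i, a i ≠ 0} (hrev : ∀ i, a i.rev = -a i) (w : Fin 3 → R)
    (hw : (strandColors S 0 (a 0).natAbs w).2 = (strandColors S 1 (a 1).natAbs w).1)
    (h : Crossing a × Fin 4) :
    symmetricColors S (glue a ha h) w = symmetricColors S h w := by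
  have hbr : ∀ h : Crossing a × Fin 4, glue a ha h = mirror hrev h →
      symmetricColors S (glue a ha h) w = symmetricColors S h w := fun h e => by
    rw [e, symmetricColors_mirror]
  have hpos : ∀ i, (a i).natAbs - 1 + 1 = (a i).natAbs := fun i =>
    Nat.sub_add_cancel (Int.natAbs_pos.mpr (ha i))
  have ht : symmetricColors S (top a ha 0, 0) w = symmetricColors S (top a ha 1, 1) w := rfl
  have hb : symmetricColors S (bottom a ha 0, 3) w = symmetricColors S (bottom a ha 1, 2) w := by
    change (strandColors S 0 ((a 0).natAbs - 1 + 1) w).2 =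
      (strandColors S 1 ((a 1).natAbs - 1 + 1) w).1
    rw [hpos, hpos, hw]
  have left : ∀ (i : Fin 4) (k : Fin (a i).natAbs) (e : Fin 4), i < 2 →
      symmetricColors S (glue a ha (⟨i, k⟩, e)) w = symmetricColors S (⟨i, k⟩, e) w := by
    rintro i ⟨k, hk⟩ e hi
    have hi' : i = 0 ∨ i = 1 := by
      clear hk
      revert i
      decide
    match e with
    | 0 =>
      cases k with
      | zero =>
        rw [← top_eq a ha i ⟨0, hk⟩ rfl]
        rcases hi' with rfl | rfl
        · rw [glue_top_zero, finRotate_apply]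
          exact ht.symm
        · apply hbr
          rw [glue_top_zero, mirror, mirrorCrossing_top, finRotate_apply]
          rfl
      | succ k =>
        rw [glue_succ_zero]
        simp [symmetricColors, hi, crossingColors]
    | 1 =>
      cases k with
      | zero =>
        rw [← top_eq a ha i ⟨0, hk⟩ rfl]
        rcases hi' with rfl | rfl
        · apply hbr
          rw [glue_top_one, mirror, mirrorCrossing_top, finRotate_symm_apply]
          rfl
        · rw [glue_top_one, finRotate_symm_apply]
          exact ht
      | succ k =>
        rw [glue_succ_one]
        simp [symmetricColors, hi, crossingColors]
    | 2 =>
      by_cases h0 : k + 1 < (a i).natAbs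
      · rw [glue_two i k h0]
        simp [symmetricColors, hi, crossingColors]
      · rw [← bottom_eq a ha i ⟨k, hk⟩ h0]
        rcases hi' with rfl | rfl
        · apply hbr
          rw [glue_bottom_two, mirror, mirrorCrossing_bottom, finRotate_symm_apply]
          rfl
        · rw [glue_bottom_two, finRotate_symm_apply]
          exact hb
    | 3 =>
      by_cases h0 : k + 1 < (a i).natAbs
      · rw [glue_three i k h0]
        simp [symmetricColors, hi, crossingColors]
      · rw [← bottom_eq a ha i ⟨k, hk⟩ h0]
        rcases hi' with rfl | rfl
        · rw [glue_bottom_three, finRotate_apply]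
          exact hb.symm
        · apply hbr
          rw [glue_bottom_three, mirror, mirrorCrossing_bottom, finRotate_apply]
          rfl
  by_cases hi : h.1.1 < 2
  · exact left _ _ _ hi
  · have hm := left _ (mirror hrev h).1.2 (mirror hrev h).2 ((rev_lt_two_iff _).mpr hi)
    change symmetricColors S (glue a ha (mirror hrev h)) w =
      symmetricColors S (mirror hrev h) w at hm
    rwa [glue_mirror, symmetricColors_mirror, symmetricColors_mirror] at hm

end

variable {a : Fin 4 → ℤ} {ha : ∀ i, a i ≠ 0} (hrev : ∀ i, a i.rev = -a i)

/-- The meridian of the mirror image of an end. -/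
theorem meridian_mirror (hodd : Odd (a 0)) (h : Crossing a × Fin 4) :
    (pretzelLink a ha).meridian (mirror hrev h) = (pretzelLink a ha).meridian h :=
  congrArg (fun x => MonoidAlgebra.of ℤ _ (Multiplicative.ofAdd (Finsupp.single x 1)))
    (component_mirror hrev hodd h)

include hrev in
theorem exists_coloring (hodd : Odd (a 0)) (o : (pretzelLink a ha).Orientation)
    (e : (pretzelLink a ha).End) : ∃ f, o.IsColoring f ∧ f ≠ 0 ∧ f e = 0 := by
  classical
  have hS : ∀ c : Crossing a, _ := fun c => exists_crossing_transfer
    ((pretzelLink a ha).meridian (c, o.overIn c)) ((pretzelLink a ha).meridian (c, o.overIn c + 3))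
    (isUnit_meridian _) ((pretzelLink a ha).upper c) (o.overIn c)
    (by simp only [pretzelLink]; split <;> simp) (o.overIn_eq_or c)
  choose T hT using hS
  -- The value `0` below the last crossing of a column never enters the colours used.
  let S : Fin 4 → ℕ → _ := fun i k => if hk : k < (a i).natAbs then T ⟨i, k, hk⟩ else 0
  have hST : ∀ c : Crossing a, S c.1 c.2 = T c := fun c => dif_pos c.2.isLt
  let F : (pretzelLink a ha).End → _ := fun h => symmetricColors (a := a) S h
  -- The two equations on the three top colours: matching at the bottom bridge, and vanishing at
  -- `e`.
  let Φ : (Fin 3 → (pretzelLink a ha).LaurentRing) →ₗ[(pretzelLink a ha).LaurentRing]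
      Fin 2 → (pretzelLink a ha).LaurentRing :=
    LinearMap.pi ![LinearMap.snd _ _ _ ∘ₗ strandColors S 0 (a 0).natAbs -
      LinearMap.fst _ _ _ ∘ₗ strandColors S 1 (a 1).natAbs, F e]
  have hΦ : ¬ Function.Injective Φ := fun hi => by
    have := card_le_of_injective _ Φ hi
    simp at this
  rw [← LinearMap.ker_eq_bot, Submodule.eq_bot_iff] at hΦ
  push Not at hΦ
  obtain ⟨w, hw, hw0⟩ := hΦ
  rw [LinearMap.mem_ker] at hw
  have hw1 : (strandColors S 0 (a 0).natAbs w).2 = (strandColors S 1 (a 1).natAbs w).1 :=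
    sub_eq_zero.mp (congrFun hw 0)
  have hw2 : F e w = 0 := congrFun hw 1
  have hmirror : ∀ h : Crossing a × Fin 4, F (mirror hrev h) w = F h w := fun h => by
    simp only [F]
    rw [symmetricColors_mirror]
  -- the relations at the crossings of the left half
  have left : ∀ c : Crossing a, c.1 < 2 →
      F (c, (pretzelLink a ha).upper c) w = F (c, (pretzelLink a ha).upper c + 2) w ∧
      (1 - (pretzelLink a ha).meridian (c, o.overIn c + 3)) * F (c, o.overIn c) w +
        (pretzelLink a ha).meridian (c, o.overIn c) * F (c, o.overIn c + 3) w =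
      F (c, o.overIn c + 1) w := by
    intro c hc
    have h1 := hT c (strandColors S c.1 c.2 w) _ (hST c ▸ crossingColors_apply S c.1 c.2 w)
    have h2 : ∀ e, F (c, e) w = crossingColors S c.1 c.2 e w := fun e => by
      simp only [F, symmetricColors, hc, if_true]
    simpa only [h2] using h1
  have hmc : ∀ (c : Crossing a) (x : Fin 4), F (mirrorCrossing hrev c, 1 - x) w = F (c, x) w :=
    fun c x => hmirror (c, x)
  have hover : ∀ c : Crossing a,
      F (c, (pretzelLink a ha).upper c + 2) w = F (c, (pretzelLink a ha).upper c) w := by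
    intro c
    by_cases hc : c.1 < 2
    · exact (left c hc).1.symm
    · have h1 := (left (mirrorCrossing hrev c) ((rev_lt_two_iff _).mpr hc)).1
      have h2 : ∀ u : Fin 4, 1 - u + 2 = 1 - (u + 2) := by decide
      rw [upper_mirrorCrossing, h2, hmc, hmc] at h1
      exact h1.symm
  have hover' : ∀ (c : Crossing a) (x : Fin 4), (x = (pretzelLink a ha).upper c ∨
      x = (pretzelLink a ha).upper c + 2) → F (c, x + 2) w = F (c, x) w := by
    rintro c x (rfl | rfl)
    · exact hover c
    · rw [hover, add_assoc, show (2 : Fin 4) + 2 = 0 from rfl, add_zero]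
  have rel : ∀ c : Crossing a, (1 - (pretzelLink a ha).meridian (c, o.overIn c + 3)) *
      F (c, o.overIn c) w + (pretzelLink a ha).meridian (c, o.overIn c) * F (c, o.overIn c + 3) w =
      F (c, o.overIn c + 1) w := by
    intro c
    by_cases hc : c.1 < 2
    · exact (left c hc).2
    · have h1 := (left (mirrorCrossing hrev c) ((rev_lt_two_iff _).mpr hc)).2
      have hmm : ∀ x : Fin 4, (pretzelLink a ha).meridian (mirrorCrossing hrev c, 1 - x) =
        (pretzelLink a ha).meridian (c, x) := fun x => meridian_mirror hrev hodd (c, x)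
      have e1 : ∀ x : Fin 4, 3 - x + 1 = 1 - (x + 1) := by decide
      have e3 : ∀ x : Fin 4, 3 - x + 3 = 1 - (x + 3) := by decide
      have e0 : ∀ x : Fin 4, 3 - x = 1 - (x + 2) := by decide
      -- Reflected back, the relation has the same left and right ends as at `c`; only entry and
      -- exit of the upper strand are exchanged, and these have equal colours and meridians.
      rw [overIn_mirrorCrossing hrev hodd, e1, e3, e0, hmc, hmc, hmc, hmm, hmm,
        hover' c _ (o.overIn_eq_or c)] at h1
      have hopp : (pretzelLink a ha).meridian (c, o.overIn c + 2) =
        (pretzelLink a ha).meridian (c, o.overIn c) :=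
          meridian_opp (D := pretzelLink a ha) c (o.overIn c)
      rwa [hopp] at h1
  refine ⟨fun h => F h w, ⟨fun h => symmetricColors_glue S hrev w hw1 h,
    fun h hh => hover' h.1 h.2 hh, rel⟩, ?_, hw2⟩
  -- The three parameters are themselves colours of top ends, so a zero colouring would force `w =
  -- 0`.
  · intro h0
    apply hw0
    funext j
    match j with
    | 0 => exact congrFun h0 (top a ha 0, 1)
    | 1 => exact congrFun h0 (top a ha 0, 0)
    | 2 => exact congrFun h0 (top a ha 1, 0)

end Pretzel

end

theorem mainTheorem3 (q r : ℕ) (hq : 0 < q) (hr : 0 < r)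
    (o : (symmetricPretzelLink q r hq).Orientation)
    (Δ : (symmetricPretzelLink q r hq).LaurentRing) :
    o.IsAlexanderPolynomial Δ ↔ Δ = 0 := by
  have hrev : ∀ i : Fin 4, symmetricCoeffs q r i.rev = -symmetricCoeffs q r i := by
    intro i
    fin_cases i <;> simp [symmetricCoeffs, Fin.rev] <;> ring
  have hodd : Odd (symmetricCoeffs q r 0) := ⟨-r - 1, by simp [symmetricCoeffs]; ring⟩
  exact LinkDiagram.Orientation.isAlexanderPolynomial_iff_eq_zero
    (Pretzel.top _ (symmetricCoeffs_ne_zero hq r) 0, 0)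
    (Pretzel.exists_coloring hrev hodd o) Δ
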